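/- Let $s,n\ge 2$. In the $s$-player problem $\mathrm{Cycle}_n$, player $i$ ($1\le i\le s$) holds a permutation $x_i\in S_n$, and the task is to output $1$ if $x_1\circ x_2\circ\cdots\circ x_s$ has exactly one cycle (fixed points counted as cycles), i.e. is an $n$-cycle, and $0$ otherwise. Communication takes place in the coordinator model: there is an additional party, the coordinator, who has no input and outputs the answer; each player exchanges bits with the coordinator over a private channel, and players cannot communicate with each other directly. In a deterministic protocol the bits sent by a player depend only on that player's input and on the bits exchanged before on that player's channel, and the actions of the coordinator depend only on all the bits exchanged so far. A public-coin randomized protocol is a probability distribution over deterministic protocols; its cost is the maximal total number of bits exchanged, over all inputs and all outcomes of the coins; it has error $\delta$ if on every input the output is wrong with probability at most $\delta$. Let $R^{s,\mathrm{pub}}_{\delta}(\mathrm{Cycle}_n)$ be the minimum cost of a public-coin protocol with error $\delta$. Then $$R^{s,\mathrm{pub}}_{1/12}(\mathrm{Cycle}_n)=\Omega(sn),$$ that is, there is an absolute constant $c>0$ such that $R^{s,\mathrm{pub}}_{1/12}(\mathrm{Cycle}_n)\ge c\,s\,n$ for all $s\ge 2$ and $n\ge 2$. -/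

import Mathlib

open scoped NNReal ENNReal

/-- One bit on the private channel between the coordinator and some player, together with its
direction. -/
inductive ChannelBit where
  /-- a bit sent by the coordinator to the player -/
  | toPlayer (b : Bool)
  /-- a bit sent by the player to the coordinator -/
  | toCoordinator (b : Bool)

/-- A deterministic strategy of the coordinator, who has no input, in a protocol with `s` players
and outputs in `O`. It is a finite tree: the position in the tree records everything the
coordinator has sent and received so far. At each moment the coordinator halts with an output, or
sends one bit to one player, or receives one bit from one player. -/
inductive Coordinator (s : ℕ) (O : Type) where
  | halt (o : O) : Coordinator s O
  | send (i : Fin s) (b : Bool) (next : Coordinator s O) : Coordinator s O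
  | receive (i : Fin s) (next : Bool → Coordinator s O) : Coordinator s O

namespace Coordinator

variable {s : ℕ} {O : Type}

/-- The output of the coordinator, when player `i` answers with the bit `answer i h` if the
sequence of bits exchanged so far on the channel of player `i` is `h` (most recent bit first).
The argument `hist` holds the current contents of the `s` channels. -/
def output (answer : Fin s → List ChannelBit → Bool) :
    Coordinator s O → (Fin s → List ChannelBit) → O
  | halt o, _ => o
  | send i b next, hist =>
      output answer next (Function.update hist i (.toPlayer b :: hist i))
  | receive i next, hist =>
      output answer (next (answer i (hist i)))
        (Function.update hist i (.toCoordinator (answer i (hist i)) :: hist i))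

/-- The total number of bits, in both directions and over all channels, exchanged in the same
execution. -/
def bits (answer : Fin s → List ChannelBit → Bool) :
    Coordinator s O → (Fin s → List ChannelBit) → ℕ
  | halt _, _ => 0
  | send i b next, hist =>
      bits answer next (Function.update hist i (.toPlayer b :: hist i)) + 1
  | receive i next, hist =>
      bits answer (next (answer i (hist i)))
        (Function.update hist i (.toCoordinator (answer i (hist i)) :: hist i)) + 1

end Coordinator

/-- A deterministic protocol in the coordinator model, with `s` players that hold inputs in `X`.
The bits that player `i` sends depend only on the input of player `i` and on the bits exchanged
earlier between player `i` and the coordinator. -/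
structure CoordinatorProtocol (s : ℕ) (X O : Type) where
  coordinator : Coordinator s O
  player : Fin s → X → List ChannelBit → Bool

namespace CoordinatorProtocol

variable {s : ℕ} {X O : Type}

/-- The output of the protocol on the input `x`. -/
def output (D : CoordinatorProtocol s X O) (x : Fin s → X) : O :=
  D.coordinator.output (fun i => D.player i (x i)) (fun _ => [])

/-- The number of bits exchanged by the protocol on the input `x`. -/
def bits (D : CoordinatorProtocol s X O) (x : Fin s → X) : ℕ :=
  D.coordinator.bits (fun i => D.player i (x i)) (fun _ => [])

end CoordinatorProtocol

/-- A public-coin randomized protocol: a probability distribution on deterministic protocols. -/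
abbrev PublicCoinProtocol (s : ℕ) (X O : Type) := PMF (CoordinatorProtocol s X O)

namespace PublicCoinProtocol

variable {s : ℕ} {X O : Type}

/-- On every input the output is wrong with probability at most `δ`. -/
def ComputesWithError (P : PublicCoinProtocol s X O) (f : (Fin s → X) → O) (δ : ℝ≥0∞) : Prop :=
  ∀ x, P.toOuterMeasure {D | D.output x ≠ f x} ≤ δ

/-- The worst-case number of bits exchanged, over all inputs and all outcomes of the coins. -/
noncomputable def cost (P : PublicCoinProtocol s X O) : ℝ≥0∞ :=
  ⨆ D ∈ P.support, ⨆ x : Fin s → X, (D.bits x : ℝ≥0∞)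

end PublicCoinProtocol

/-- The `δ`-error public-coin randomized communication complexity of `f` in the coordinator model
with `s` players. -/
noncomputable def publicCoinComplexity {s : ℕ} {X O : Type} (f : (Fin s → X) → O) (δ : ℝ≥0∞) :
    ℝ≥0∞ :=
  ⨅ (P : PublicCoinProtocol s X O) (_ : P.ComputesWithError f δ), P.cost

open Classical in
/-- The `s`-player cycle problem: decide whether `x₁ ∘ x₂ ∘ ⋯ ∘ x_s` consists of exactly one
cycle (fixed points count as cycles), that is, whether it moves the `n` points in one cycle of
length `n`. -/
noncomputable def cycleProblem (s n : ℕ) (x : Fin s → Equiv.Perm (Fin n)) : Bool :=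
  decide ((List.ofFn x).prod.IsCycleOn Set.univ)

namespace Coordinator

variable {s : ℕ} {O : Type}

/-- The contents of the `s` channels at the end of an execution. -/
def channels (answer : Fin s → List ChannelBit → Bool) :
    Coordinator s O → (Fin s → List ChannelBit) → Fin s → List ChannelBit
  | halt _, hist => hist
  | send i b next, hist =>
      channels answer next (Function.update hist i (.toPlayer b :: hist i))
  | receive i next, hist =>
      channels answer (next (answer i (hist i)))
        (Function.update hist i (.toCoordinator (answer i (hist i)) :: hist i))

/-- A history is consistent with the answers of a player if each bit sent by the player is the
answer to the history before that bit. -/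
def Consistent (ans : List ChannelBit → Bool) : List ChannelBit → Prop
  | [] => True
  | .toPlayer _ :: h => Consistent ans h
  | .toCoordinator b :: h => ans h = b ∧ Consistent ans h

lemma sum_length_update (hist : Fin s → List ChannelBit) (i : Fin s) (b : ChannelBit) :
    ∑ j, (Function.update hist i (b :: hist i) j).length = ∑ j, (hist j).length + 1 := by
  have h : ∀ j, (Function.update hist i (b :: hist i) j).length
      = (hist j).length + if j = i then 1 else 0 := by
    intro j
    by_cases hj : j = i
    · subst hj; simp
    · simp [hj]
  simp [h, Finset.sum_add_distrib]

lemma sum_length_channels (answer : Fin s → List ChannelBit → Bool) (c : Coordinator s O)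
    (hist : Fin s → List ChannelBit) :
    ∑ j, (c.channels answer hist j).length
      = c.bits answer hist + ∑ j, (hist j).length := by
  induction c generalizing hist with
  | halt o => simp [channels, bits]
  | send i b next ih => rw [channels, bits, ih, sum_length_update]; ring
  | receive i next ih => rw [channels, bits, ih, sum_length_update]; ring

lemma suffix_channels (answer : Fin s → List ChannelBit → Bool) (c : Coordinator s O)
    (hist : Fin s → List ChannelBit) (i : Fin s) :
    hist i <:+ c.channels answer hist i := by
  have upd : ∀ (hist : Fin s → List ChannelBit) (j : Fin s) (b : ChannelBit),
      hist i <:+ Function.update hist j (b :: hist j) i := by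
    intro hist j b
    by_cases hj : i = j
    · subst hj; simp
    · simp [hj]
  induction c generalizing hist with
  | halt o => exact List.suffix_refl _
  | send j b next ih => exact (upd hist j _).trans (ih _)
  | receive j next ih => exact (upd hist j _).trans (ih _ _)

lemma Consistent.of_suffix {ans : List ChannelBit → Bool} {h h' : List ChannelBit}
    (hc : Consistent ans h) (hs : h' <:+ h) : Consistent ans h' := by
  induction h with
  | nil => rw [List.suffix_nil.1 hs]; trivial
  | cons b t ih =>
    rcases List.suffix_cons_iff.1 hs with rfl | hs'
    · exact hc
    · cases b with
      | toPlayer b => exact ih hc hs'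
      | toCoordinator b => exact ih hc.2 hs'

lemma consistent_channels (answer : Fin s → List ChannelBit → Bool) (c : Coordinator s O)
    (hist : Fin s → List ChannelBit) (i : Fin s) (h : Consistent (answer i) (hist i)) :
    Consistent (answer i) (c.channels answer hist i) := by
  induction c generalizing hist with
  | halt o => exact h
  | send j b next ih =>
    refine ih _ ?_
    by_cases hj : i = j
    · subst hj; simpa [Consistent] using h
    · simpa [hj] using h
  | receive j next ih =>
    refine ih _ _ ?_
    by_cases hj : i = j
    · subst hj; simpa [Consistent] using h
    · simpa [hj] using h

/-- Replacing the answers of one player by answers consistent with the final contents of the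
channel of that player does not change the execution. -/
lemma run_update_of_consistent (answer : Fin s → List ChannelBit → Bool) (c : Coordinator s O)
    (hist : Fin s → List ChannelBit) (i : Fin s) (ans : List ChannelBit → Bool)
    (h : Consistent ans (c.channels answer hist i)) :
    c.channels (Function.update answer i ans) hist = c.channels answer hist ∧
      c.output (Function.update answer i ans) hist = c.output answer hist := by
  induction c generalizing hist with
  | halt o => exact ⟨rfl, rfl⟩
  | send j b next ih => exact ih _ h
  | receive j next ih =>
    have key : Function.update answer i ans j (hist j) = answer j (hist j) := by
      by_cases hj : j = i
      · subst hj
        rw [channels] at h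
        have h1 := h.of_suffix (suffix_channels _ _ _ _)
        rw [Function.update_self] at h1
        rw [Function.update_self]
        exact h1.1
      · simp [hj]
    simp only [channels, output, key]
    exact ih _ _ h

end Coordinator

namespace CoordinatorProtocol

variable {s : ℕ} {X O : Type}

/-- The contents of the `s` channels at the end of the execution on the input `x`. -/
def channels (D : CoordinatorProtocol s X O) (x : Fin s → X) : Fin s → List ChannelBit :=
  D.coordinator.channels (fun i => D.player i (x i)) (fun _ => [])

lemma sum_length_channels (D : CoordinatorProtocol s X O) (x : Fin s → X) :
    ∑ i, (D.channels x i).length = D.bits x := by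
  simpa [channels, CoordinatorProtocol.bits] using Coordinator.sum_length_channels (fun i => D.player i (x i)) D.coordinator
    (fun _ => [])

/-- The cut-and-paste property of the channel of one player. -/
lemma run_update_of_channels_eq (D : CoordinatorProtocol s X O) (i : Fin s) {x y z : Fin s → X}
    (h : D.channels x i = D.channels y i) (hz : z i = x i) (hz' : ∀ j, j ≠ i → z j = y j) :
    D.channels z i = D.channels x i ∧ D.output z = D.output y := by
  have hc : Coordinator.Consistent (D.player i (x i)) (D.channels y i) := by
    rw [← h]
    exact Coordinator.consistent_channels (fun j => D.player j (x j)) _ _ i trivial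
  have hu : (fun j => D.player j (z j))
      = Function.update (fun j => D.player j (y j)) i (D.player i (x i)) := by
    funext j
    by_cases hj : j = i
    · subst hj; simp [hz]
    · simp [hj, hz' j hj]
  have := Coordinator.run_update_of_consistent _ _ _ i _ hc
  rw [← hu] at this
  exact ⟨(congrFun this.1 i).trans h.symm, this.2⟩

end CoordinatorProtocol

namespace Equiv.Perm

variable {α β : Type*}

lemma isCycleOn_univ_iff {f : Perm α} :
    f.IsCycleOn _root_.Set.univ ↔ ∀ x y, f.SameCycle x y :=
  ⟨fun h x y => h.2 (Set.mem_univ x) (Set.mem_univ y),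
    fun h => ⟨Set.bijOn_univ.2 f.bijective, fun x _ y _ => h x y⟩⟩

/-- A map that sends each step of `f` into a cycle of `g` sends cycles of `f` into cycles
of `g`. -/
lemma SameCycle.map_of_step {f : Perm α} {g : Perm β} {r : α → β}
    (hr : ∀ x, g.SameCycle (r x) (r (f x))) {x y : α} (h : f.SameCycle x y) :
    g.SameCycle (r x) (r y) := by
  obtain ⟨i, rfl⟩ := h
  induction i using Int.induction_on with
  | zero => exact SameCycle.refl _ _
  | succ i ih =>
    rw [add_comm, zpow_add, zpow_one, mul_apply]
    exact ih.trans (hr _)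
  | pred i ih =>
    refine ih.trans ?_
    have := hr ((f ^ (-(i : ℤ) - 1)) x)
    rw [← mul_apply, ← zpow_one_add, add_sub_cancel] at this
    exact this.symm

lemma sameCycle_of_apply_eq {f : Perm α} {x y : α} (h : f x = y) : f.SameCycle x y :=
  ⟨1, by simpa using h⟩

lemma isCycleOn_univ_permCongr (e : α ≃ β) (f : Perm α) :
    (e.permCongr f).IsCycleOn _root_.Set.univ ↔ f.IsCycleOn _root_.Set.univ := by
  simp only [isCycleOn_univ_iff]
  constructor
  · intro h x y
    have := SameCycle.map_of_step (g := f) (r := e.symm) (fun x => ?_) (h (e x) (e y))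
    · simpa using this
    · exact sameCycle_of_apply_eq (by simp)
  · intro h x y
    have := SameCycle.map_of_step (g := e.permCongr f) (r := e) (fun x => ?_)
      (h (e.symm x) (e.symm y))
    · simpa using this
    · exact sameCycle_of_apply_eq (by simp)

lemma isCycleOn_univ_conj (f g : Perm α) :
    (g⁻¹ * f * g).IsCycleOn _root_.Set.univ ↔ f.IsCycleOn _root_.Set.univ := by
  rw [← isCycleOn_univ_permCongr g⁻¹ f]
  rfl

/-- Inserting a new point into one of the cycles preserves the number of cycles. -/
lemma isCycleOn_univ_insert [DecidableEq α] (f : Perm α) (x₀ : α) :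
    IsCycleOn (f.optionCongr * swap none (some x₀)) _root_.Set.univ ↔ f.IsCycleOn _root_.Set.univ := by
  simp only [isCycleOn_univ_iff]
  set g : Perm (Option α) := f.optionCongr * swap none (some x₀) with hg
  have g0 : g none = some (f x₀) := by simp [hg]
  have g1 : g (some x₀) = none := by simp [hg]
  have g2 : ∀ x, x ≠ x₀ → g (some x) = some (f x) := by
    intro x hx
    simp [hg, swap_apply_of_ne_of_ne, hx]
  constructor
  · intro h x y
    refine SameCycle.map_of_step (r := fun o : Option α => o.getD x₀) (fun o => ?_)
      (h (some x) (some y))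
    cases o with
    | none => rw [g0]; exact sameCycle_of_apply_eq rfl
    | some z =>
      by_cases hz : z = x₀
      · subst hz; rw [g1]; exact SameCycle.refl _ _
      · rw [g2 z hz]; exact sameCycle_of_apply_eq rfl
  · intro h
    have hn : g.SameCycle none (some (f x₀)) := sameCycle_of_apply_eq g0
    have hs : ∀ x y, g.SameCycle (some x) (some y) := by
      intro x y
      refine SameCycle.map_of_step (f := f) (r := some) (fun z => ?_) (h x y)
      by_cases hz : z = x₀
      · subst hz; exact (sameCycle_of_apply_eq g1).trans hn
      · exact sameCycle_of_apply_eq (g2 z hz)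
    have hn' : ∀ x, g.SameCycle none (some x) := fun x => hn.trans (hs _ _)
    intro x y
    cases x <;> cases y
    · exact SameCycle.refl _ _
    · exact hn' _
    · exact (hn' _).symm
    · exact hs _ _

/-- The permutation that moves each of `l + 1` cyclically arranged layers to the next one, acting
by `C k` between layer `k` and layer `k + 1`. -/
def layered {l : ℕ} (C : Fin (l + 1) → Perm β) : Perm (Fin (l + 1) × β) :=
  (prodCongr (finRotate (l + 1)) 1) * (prodShear 1 C)

lemma layered_apply {l : ℕ} (C : Fin (l + 1) → Perm β) (k : Fin (l + 1)) (j : β) :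
    layered C (k, j) = (k + 1, C k j) := by
  simp [layered, prodShear]

/-- The composition of the first `k` permutations of a sequence, applied in their order. -/
def composition (C : ℕ → Perm β) : ℕ → Perm β
  | 0 => 1
  | k + 1 => C k * composition C k

lemma isCycleOn_univ_layered (l : ℕ) (C : ℕ → Perm β) :
    (layered fun k : Fin (l + 1) => C k).IsCycleOn _root_.Set.univ ↔
      (composition C (l + 1)).IsCycleOn _root_.Set.univ := by
  simp only [isCycleOn_univ_iff]
  set π := layered fun k : Fin (l + 1) => C k with hπ
  have step : ∀ k (hk : k < l) j, π (⟨k, by omega⟩, j) = (⟨k + 1, by omega⟩, C k j) := by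
    intro k hk j
    rw [hπ, layered_apply]
    congr 1
    ext
    rw [Fin.val_add_one_of_lt (by simpa [Fin.lt_def] using hk)]
  have last : ∀ j, π (⟨l, by omega⟩, j) = (0, C l j) := by
    intro j
    rw [hπ, layered_apply]
    congr 1
    exact Fin.last_add_one l
  constructor
  · intro h x y
    refine SameCycle.map_of_step
      (r := fun p : Fin (l + 1) × β => (composition C p.1)⁻¹ p.2) ?_ (h (0, x) (0, y))
    rintro ⟨⟨k, hk⟩, j⟩
    rcases Nat.lt_succ_iff_lt_or_eq.1 hk with hk | rfl
    · rw [step k hk]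
      simp [composition]
      rfl
    · rw [last]
      exact sameCycle_of_apply_eq (by simp [composition])
  · intro h
    have run : ∀ k (hk : k < l + 1) j,
        π.SameCycle (0, j) (⟨k, hk⟩, composition C k j) := by
      intro k hk j
      induction k with
      | zero => exact SameCycle.refl _ _
      | succ k ih =>
        exact (ih (by omega)).trans (sameCycle_of_apply_eq (step k (by omega) _))
    have zero : ∀ x y, π.SameCycle (0, x) (0, y) := by
      intro x y
      refine SameCycle.map_of_step (f := composition C (l + 1)) (r := fun j => (0, j))
        (fun j => ?_) (h x y)
      exact (run l (by omega) j).trans (sameCycle_of_apply_eq (last _))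
    have any : ∀ p, ∃ x, π.SameCycle (0, x) p := by
      rintro ⟨⟨k, hk⟩, j⟩
      exact ⟨(composition C k)⁻¹ j, by simpa using run k hk ((composition C k)⁻¹ j)⟩
    intro p q
    obtain ⟨x, hx⟩ := any p
    obtain ⟨y, hy⟩ := any q
    exact hx.symm.trans ((zero x y).trans hy)

end Equiv.Perm

section CycleReduction

open Equiv Equiv.Perm

/-- The number of common ones of two bit vectors. -/
def commonOnes {m : ℕ} (u v : Fin m → Bool) : ℕ := ∑ i, if u i && v i then 1 else 0

/-- The swap `σ` if the bit is set, and the identity otherwise. -/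
def bitPerm (σ : Perm (Fin 3)) (b : Bool) : Perm (Fin 3) := if b then σ else 1

/-- Extension of a bit vector to all natural numbers by zeros. -/
def extendBits {m : ℕ} (u : Fin m → Bool) (k : ℕ) : Bool := if h : k < m then u ⟨k, h⟩ else false

lemma composition_bitPerm {m : ℕ} (u v : Fin m → Bool) (i : ℕ) :
    composition (fun k => bitPerm (swap 0 1) (extendBits u (k / 2)) *
        bitPerm (swap 1 2) (extendBits v (k / 2))) (2 * i)
      = ((swap 0 1 * swap 1 2) ^ 2) ^
        (∑ k ∈ Finset.range i, if extendBits u k && extendBits v k then 1 else 0) := by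
  induction i with
  | zero => rfl
  | succ i ih =>
    rw [Finset.sum_range_succ, Nat.mul_succ, composition, composition, ih,
      add_comm (∑ k ∈ Finset.range i, _), pow_add, ← mul_assoc]
    congr 1
    have h1 : (2 * i + 1) / 2 = i := by omega
    have h2 : 2 * i / 2 = i := by omega
    rw [h1, h2]
    generalize extendBits u i = b
    generalize extendBits v i = c
    revert b c
    decide

lemma isCycleOn_univ_threeCycle_pow (t : ℕ) :
    (((swap 0 1 * swap 1 2 : Perm (Fin 3)) ^ 2) ^ t).IsCycleOn _root_.Set.univ ↔ ¬ 3 ∣ t := by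
  have h3 : ((swap 0 1 * swap 1 2 : Perm (Fin 3)) ^ 2) ^ 3 = 1 := by decide
  rw [← Nat.mod_add_div t 3, pow_add, pow_mul, h3, one_pow, mul_one, isCycleOn_univ_iff]
  have : t % 3 < 3 := Nat.mod_lt _ (by norm_num)
  generalize t % 3 = q at *
  rw [← Nat.dvd_add_iff_left (dvd_mul_right _ _)]
  interval_cases q <;> decide

/-- A reduction of the inner product modulo three to the two-player cycle problem. -/
def ReducesToCycle (m : ℕ) (α : Type) : Prop :=
  ∃ a b : (Fin m → Bool) → Perm α, ∀ u v,
    (a u * b v).IsCycleOn _root_.Set.univ ↔ ¬ 3 ∣ commonOnes u v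

lemma ReducesToCycle.congr {m : ℕ} {α β : Type} (h : ReducesToCycle m α) (e : α ≃ β) :
    ReducesToCycle m β := by
  obtain ⟨a, b, hab⟩ := h
  refine ⟨fun u => e.permCongr (a u), fun v => e.permCongr (b v), fun u v => ?_⟩
  rw [← hab, ← isCycleOn_univ_permCongr e]
  simp only [Equiv.permCongr_mul]

lemma ReducesToCycle.option {m : ℕ} {α : Type} [Nonempty α] (h : ReducesToCycle m α) :
    ReducesToCycle m (Option α) := by
  classical
  obtain ⟨a, b, hab⟩ := h
  obtain ⟨x₀⟩ := ‹Nonempty α›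
  refine ⟨fun u => (a u).optionCongr, fun v => (b v).optionCongr * swap none (some x₀),
    fun u v => ?_⟩
  rw [← hab, ← isCycleOn_univ_insert _ x₀, ← mul_assoc]
  congr! 2
  ext x : 1
  cases x <;> simp

lemma reducesToCycle_layers (m : ℕ) (hm : 1 ≤ m) : ReducesToCycle m (Fin (2 * m) × Fin 3) := by
  obtain ⟨l, hl⟩ : ∃ l, 2 * m = l + 1 := ⟨2 * m - 1, by omega⟩
  rw [hl]
  refine ⟨fun u => layered fun k => bitPerm (swap 0 1) (extendBits u (k / 2)),
    fun v => prodShear 1 fun k => bitPerm (swap 1 2) (extendBits v (k / 2)), fun u v => ?_⟩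
  have hprod : ∀ A B : Fin (l + 1) → Perm (Fin 3),
      layered A * (prodShear 1 B : Perm _) = layered fun k => A k * B k := by
    intro A B
    ext1 ⟨k, j⟩
    simp [layered_apply, prodShear]
  rw [hprod, isCycleOn_univ_layered l (fun k => bitPerm (swap 0 1) (extendBits u (k / 2)) *
        bitPerm (swap 1 2) (extendBits v (k / 2))), ← hl, composition_bitPerm,
    isCycleOn_univ_threeCycle_pow, Finset.sum_range]
  simp [extendBits, commonOnes]

lemma reducesToCycle_fin (m n : ℕ) (hm : 1 ≤ m) (h : 6 * m ≤ n) : ReducesToCycle m (Fin n) := by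
  induction n, h using Nat.le_induction with
  | base =>
    refine (reducesToCycle_layers m hm).congr (finProdFinEquiv.trans (finCongr (by ring)))
  | succ n hn ih =>
    have : Nonempty (Fin n) := ⟨⟨0, by omega⟩⟩
    exact ih.option.congr (finSuccEquiv n).symm

end CycleReduction

open Finset in
/-- Every function of `u` and `v` that has the cut-and-paste property of a two-party protocol
computes `f` wrongly or with a transcript of more than `T` bits, on a quarter of all inputs. -/
def HardForTwoParties {U V : Type} [Fintype U] [Fintype V] (T : ℕ) (f : U → V → Bool) : Prop :=
  ∀ (h : U → V → List ChannelBit) (out : U → V → Bool),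
    (∀ u v u' v', h u v = h u' v' → h u v' = h u v ∧ out u v' = out u' v') →
    Fintype.card U * Fintype.card V ≤
      4 * #{p : U × V | out p.1 p.2 ≠ f p.1 p.2 ∨ T < (h p.1 p.2).length}

lemma hardForTwoParties_zero (f : Bool → Unit → Bool) (hf : f true () ≠ f false ()) :
    HardForTwoParties 0 f := by
  intro h out hcut
  have hpos : 0 < Finset.card
      {p : Bool × Unit | out p.1 p.2 ≠ f p.1 p.2 ∨ 0 < (h p.1 p.2).length} := by
    rw [Finset.card_pos]
    by_contra hne
    rw [Finset.not_nonempty_iff_eq_empty, Finset.filter_eq_empty_iff] at hne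
    have h1 := hne (Finset.mem_univ (true, ()))
    have h2 := hne (Finset.mem_univ (false, ()))
    simp only [not_or, not_not, not_lt, nonpos_iff_eq_zero, List.length_eq_zero_iff] at h1 h2
    have h3 := (hcut true () false () (h1.2.trans h2.2.symm)).2
    exact hf (h1.1.symm.trans (h3.trans h2.1))
  simp only [Fintype.card_bool, Fintype.card_unit]
  omega

/-- A primitive third root of unity. -/
noncomputable def thirdRoot : ℂ := ⟨-1 / 2, √3 / 2⟩

lemma thirdRoot_mul_conj : thirdRoot * (starRingEnd ℂ) thirdRoot = 1 := by
  have : √3 * √3 = 3 := Real.mul_self_sqrt (by norm_num)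
  apply Complex.ext <;> simp [thirdRoot] <;> nlinarith

lemma norm_one_add_thirdRoot : ‖1 + thirdRoot‖ = 1 := by
  have : √3 * √3 = 3 := Real.mul_self_sqrt (by norm_num)
  rw [← sq_eq_sq₀ (norm_nonneg _) zero_le_one, Complex.sq_norm, Complex.normSq_apply]
  simp [thirdRoot]
  nlinarith

lemma norm_one_add_conj_thirdRoot : ‖1 + (starRingEnd ℂ) thirdRoot‖ = 1 := by
  rw [← norm_one_add_thirdRoot, ← RCLike.norm_conj (1 + thirdRoot), map_add, map_one]

lemma thirdRoot_pow_re (t : ℕ) :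
    (if 3 ∣ t then 1 else 0 : ℝ) = 1 / 3 + 2 / 3 * (thirdRoot ^ t).re := by
  have h : √3 * √3 = 3 := Real.mul_self_sqrt (by norm_num)
  have h2 : (thirdRoot ^ 2).re = -1 / 2 := by
    simp [thirdRoot, pow_two]; nlinarith
  have h3 : thirdRoot ^ 3 = 1 := by
    apply Complex.ext <;> simp [thirdRoot, pow_succ]
    · linear_combination (3 / 8) * h
    · linear_combination (-√3 / 8) * h
  have hd : 3 ∣ t ↔ 3 ∣ t % 3 := (Nat.dvd_mod_iff dvd_rfl).symm
  simp only [hd]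
  conv_rhs => rw [← Nat.mod_add_div t 3, pow_add, pow_mul, h3, one_pow, mul_one]
  have : t % 3 < 3 := Nat.mod_lt _ (by norm_num)
  generalize t % 3 = q at *
  interval_cases q
  · norm_num
  · norm_num [thirdRoot]
  · rw [h2]; norm_num

section Discrepancy

variable {m : ℕ}

/-- The factor contributed by a pair of bits to `thirdRoot ^ commonOnes u v`. -/
noncomputable def bitCharacter (b c : Bool) : ℂ := if b && c then thirdRoot else 1

lemma thirdRoot_pow_commonOnes (u v : Fin m → Bool) :
    thirdRoot ^ commonOnes u v = ∏ i, bitCharacter (u i) (v i) := by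
  rw [commonOnes, ← Finset.prod_pow_eq_pow_sum]
  refine Finset.prod_congr rfl fun i _ => ?_
  unfold bitCharacter
  split_ifs <;> simp

lemma norm_sum_bitCharacter (c c' : Bool) :
    ‖∑ b, bitCharacter b c * (starRingEnd ℂ) (bitCharacter b c')‖ = if c = c' then 2 else 1 := by
  cases c <;> cases c' <;>
    simp [bitCharacter, thirdRoot_mul_conj, add_comm _ (1 : ℂ), norm_one_add_thirdRoot,
      norm_one_add_conj_thirdRoot]
  all_goals norm_num

lemma sum_pi_prod {R : Type*} [CommSemiring R] (g : Fin m → Bool → R) :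
    ∑ u : Fin m → Bool, ∏ i, g i (u i) = ∏ i, ∑ b, g i b := by
  rw [Finset.prod_univ_sum, Fintype.piFinset_univ]

lemma sum_norm_sq_le (B : Finset (Fin m → Bool)) :
    ∑ u : Fin m → Bool, ‖∑ v ∈ B, thirdRoot ^ commonOnes u v‖ ^ 2 ≤ 6 ^ m := by
  have expand : ((∑ u : Fin m → Bool, ‖∑ v ∈ B, thirdRoot ^ commonOnes u v‖ ^ 2 : ℝ) : ℂ)
      = ∑ v ∈ B, ∑ v' ∈ B,
        ∏ i, ∑ b, bitCharacter b (v i) * (starRingEnd ℂ) (bitCharacter b (v' i)) := by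
    simp only [← sum_pi_prod, Complex.ofReal_sum, Complex.ofReal_pow, ← Complex.mul_conj']
    simp only [map_sum, Finset.sum_mul_sum, thirdRoot_pow_commonOnes, map_prod,
      ← Finset.prod_mul_distrib]
    rw [Finset.sum_comm]
    exact Finset.sum_congr rfl fun v _ => Finset.sum_comm
  have nonneg : 0 ≤ ∑ u : Fin m → Bool, ‖∑ v ∈ B, thirdRoot ^ commonOnes u v‖ ^ 2 :=
    Finset.sum_nonneg fun _ _ => sq_nonneg _
  rw [← Complex.norm_of_nonneg nonneg, expand]
  have K0 : ∀ v v' : Fin m → Bool, (0 : ℝ) ≤ ∏ i, if v i = v' i then 2 else 1 :=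
    fun v v' => Finset.prod_nonneg fun i _ => by split_ifs <;> norm_num
  calc _ ≤ ∑ v ∈ B, ∑ v' ∈ B, ∏ i, (if v i = v' i then 2 else 1 : ℝ) := by
        refine (norm_sum_le _ _).trans (Finset.sum_le_sum fun v _ => ?_)
        refine (norm_sum_le _ _).trans (Finset.sum_le_sum fun v' _ => ?_)
        simp only [norm_prod, norm_sum_bitCharacter, le_refl]
    _ ≤ ∑ v : Fin m → Bool, ∑ v' : Fin m → Bool, ∏ i, (if v i = v' i then 2 else 1 : ℝ) := by
        refine (Finset.sum_le_sum fun v _ => Finset.sum_le_sum_of_subset_of_nonneg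
          (Finset.subset_univ _) fun v' _ _ => K0 v v').trans ?_
        exact Finset.sum_le_sum_of_subset_of_nonneg (Finset.subset_univ _)
          fun v _ _ => Finset.sum_nonneg fun v' _ => K0 v v'
    _ = 6 ^ m := by
        have h3 : ∀ c : Bool, ∑ b, (if c = b then 2 else 1 : ℝ) = 3 := by
          intro c; cases c <;> simp <;> norm_num
        simp only [fun v : Fin m → Bool => sum_pi_prod fun i b => (if v i = b then 2 else 1 : ℝ),
          h3]
        simp only [Finset.prod_const, Finset.card_univ, Fintype.card_fin, Finset.sum_const,
          Fintype.card_pi, Fintype.card_bool, nsmul_eq_mul, Nat.cast_pow, Nat.cast_ofNat]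
        rw [← mul_pow]
        norm_num

/-- The discrepancy of the inner product modulo three on combinatorial rectangles. -/
lemma norm_sum_rectangle_le (A B : Finset (Fin m → Bool)) :
    ‖∑ u ∈ A, ∑ v ∈ B, thirdRoot ^ commonOnes u v‖ ≤ √(12 ^ m) := by
  apply Real.le_sqrt_of_sq_le
  calc _ ≤ (∑ u ∈ A, ‖∑ v ∈ B, thirdRoot ^ commonOnes u v‖) ^ 2 := by
        gcongr
        exact norm_sum_le _ _
    _ ≤ A.card * ∑ u ∈ A, ‖∑ v ∈ B, thirdRoot ^ commonOnes u v‖ ^ 2 := sq_sum_le_card_mul_sum_sq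
    _ ≤ 2 ^ m * 6 ^ m := by
        gcongr
        · have := Finset.card_le_univ A
          simp only [Fintype.card_pi, Fintype.card_bool, Finset.prod_const, Finset.card_univ,
            Fintype.card_fin] at this
          exact_mod_cast this
        · exact (Finset.sum_le_sum_of_subset_of_nonneg (Finset.subset_univ _)
            fun _ _ _ => sq_nonneg _).trans (sum_norm_sq_le B)
    _ = 12 ^ m := by rw [← mul_pow]; norm_num

open Finset in
/-- On a rectangle, every constant is a wrong value of the inner product modulo three on about
a third of the inputs. -/
lemma card_rectangle_wrong (A B : Finset (Fin m → Bool)) (o : Bool) :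
    (#(A ×ˢ B) : ℝ) / 3 - √(12 ^ m) ≤
      #{p ∈ A ×ˢ B | o ≠ decide (¬ 3 ∣ commonOnes p.1 p.2)} := by
  set S := ∑ u ∈ A, ∑ v ∈ B, thirdRoot ^ commonOnes u v with hS
  have hz : (#{p ∈ A ×ˢ B | 3 ∣ commonOnes p.1 p.2} : ℝ) = #(A ×ˢ B) / 3 + 2 / 3 * S.re := by
    rw [Finset.card_filter, Nat.cast_sum]
    simp only [Nat.cast_ite, Nat.cast_one, Nat.cast_zero, thirdRoot_pow_re]
    rw [Finset.sum_add_distrib, ← Finset.mul_sum, hS]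
    simp only [Complex.re_sum, Finset.sum_const, nsmul_eq_mul, Finset.card_product,
      Finset.sum_product]
    push_cast
    ring
  have hn := Finset.card_filter_add_card_filter_not (s := A ×ˢ B)
    (fun p => 3 ∣ commonOnes p.1 p.2)
  have hn' : (#{p ∈ A ×ˢ B | 3 ∣ commonOnes p.1 p.2} : ℝ)
      + #{p ∈ A ×ˢ B | ¬ 3 ∣ commonOnes p.1 p.2} = #(A ×ˢ B) := by exact_mod_cast hn
  have hb := abs_le.1 ((Complex.abs_re_le_norm S).trans (norm_sum_rectangle_le A B))
  have h0 : (0 : ℝ) ≤ #(A ×ˢ B) := Nat.cast_nonneg _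
  have h1 := Real.sqrt_nonneg (12 ^ m)
  cases o
  · have : ∀ p : (Fin m → Bool) × (Fin m → Bool),
        false ≠ decide (¬ 3 ∣ commonOnes p.1 p.2) ↔ ¬ 3 ∣ commonOnes p.1 p.2 := by
      intro p; simp
    simp only [this]
    linarith
  · have : ∀ p : (Fin m → Bool) × (Fin m → Bool),
        true ≠ decide (¬ 3 ∣ commonOnes p.1 p.2) ↔ 3 ∣ commonOnes p.1 p.2 := by
      intro p; simp
    simp only [this]
    linarith

end Discrepancy

open Finset in
lemma exists_finset_lists (T : ℕ) :
    ∃ L : Finset (List ChannelBit), (∀ h, h.length ≤ T → h ∈ L) ∧ 3 * #L + 1 ≤ 4 ^ (T + 1) := by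
  classical
  let E : Finset ChannelBit := {.toPlayer true, .toPlayer false, .toCoordinator true,
    .toCoordinator false}
  have hE : ∀ b, b ∈ E := by
    intro b
    rcases b with (_ | _) | (_ | _) <;> simp [E]
  have hE4 : #E ≤ 4 := card_le_four
  induction T with
  | zero =>
    refine ⟨{[]}, fun h hh => ?_, by simp⟩
    simpa using hh
  | succ T ih =>
    obtain ⟨L, hL, hc⟩ := ih
    refine ⟨insert [] ((E ×ˢ L).image fun p => p.1 :: p.2), fun h hh => ?_, ?_⟩
    · cases h with
      | nil => simp
      | cons b t =>
        refine mem_insert_of_mem (mem_image.2 ⟨(b, t), mem_product.2 ⟨hE b, hL t ?_⟩, rfl⟩)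
        simpa using hh
    · have h1 := card_insert_le [] ((E ×ˢ L).image fun p => p.1 :: p.2)
      have h2 : #((E ×ˢ L).image fun p => p.1 :: p.2) ≤ #E * #L :=
        card_image_le.trans (card_product _ _).le
      have h3 : #E * #L ≤ 4 * #L := Nat.mul_le_mul_right _ hE4
      rw [pow_succ]
      omega

lemma discrepancy_arith {m T : ℕ} (h : 10 * (T + 3) ≤ m) :
    (4 : ℝ) ^ (T + 3) * √(12 ^ m) ≤ 4 ^ m := by
  have key : (16 : ℝ) ^ (T + 3) * 12 ^ m ≤ 16 ^ m := by
    obtain ⟨r, rfl⟩ := Nat.exists_eq_add_of_le h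
    rw [pow_add 12, pow_add 16 (10 * (T + 3)), pow_mul, pow_mul, ← mul_assoc, ← mul_pow]
    gcongr <;> norm_num
  have sq : ∀ k : ℕ, ((4 : ℝ) ^ k) ^ 2 = 16 ^ k := by
    intro k
    rw [← pow_mul, mul_comm, pow_mul]
    norm_num
  rw [← sq_le_sq₀ (by positivity) (by positivity), mul_pow, Real.sq_sqrt (by positivity), sq, sq]
  exact key

open Finset in
lemma hardForTwoParties_commonOnes {m T : ℕ} (hmT : 10 * (T + 3) ≤ m) :
    HardForTwoParties T fun u v : Fin m → Bool => decide (¬ 3 ∣ commonOnes u v) := by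
  classical
  intro h out hcut
  obtain ⟨L, hL, hLc⟩ := exists_finset_lists T
  let S : Finset ((Fin m → Bool) × (Fin m → Bool)) := {p | (h p.1 p.2).length ≤ T}
  let W : Finset ((Fin m → Bool) × (Fin m → Bool)) :=
    {p | out p.1 p.2 ≠ decide (¬ 3 ∣ commonOnes p.1 p.2)}
  let key : (Fin m → Bool) × (Fin m → Bool) → List ChannelBit × Bool :=
    fun p => (h p.1 p.2, out p.1 p.2)
  have hmaps : ∀ p ∈ S, key p ∈ L ×ˢ (univ : Finset Bool) := fun p hp =>
    mem_product.2 ⟨hL _ (mem_filter.1 hp).2, mem_univ _⟩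
  have fiber : ∀ k ∈ L ×ˢ (univ : Finset Bool),
      (#{p ∈ S | key p = k} : ℝ) / 3 - √(12 ^ m) ≤ #{p ∈ S ∩ W | key p = k} := by
    rintro ⟨l, o⟩ -
    by_cases hl : l.length ≤ T
    · let A : Finset (Fin m → Bool) := {u | ∃ v, h u v = l}
      let B : Finset (Fin m → Bool) := {v | ∃ u, h u v = l ∧ out u v = o}
      have hAB : ∀ p, p ∈ A ×ˢ B ↔ h p.1 p.2 = l ∧ out p.1 p.2 = o := by
        rintro ⟨u, v⟩
        simp only [A, B, mem_product, mem_filter, mem_univ, true_and]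
        constructor
        · rintro ⟨⟨v', h1⟩, u', h2, h3⟩
          have := hcut u v' u' v (h1.trans h2.symm)
          exact ⟨this.1.trans h1, this.2.trans h3⟩
        · rintro ⟨h1, h2⟩
          exact ⟨⟨v, h1⟩, u, h1, h2⟩
      have e1 : ({p ∈ S | key p = (l, o)} : Finset _) = A ×ˢ B := by
        ext p
        rw [hAB]
        simp only [S, key, mem_filter, mem_univ, true_and, Prod.mk.injEq]
        constructor
        · exact fun hp => hp.2
        · exact fun hp => ⟨hp.1 ▸ hl, hp⟩
      have e2 : ({p ∈ S ∩ W | key p = (l, o)} : Finset _)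
          = {p ∈ A ×ˢ B | o ≠ decide (¬ 3 ∣ commonOnes p.1 p.2)} := by
        ext p
        rw [mem_filter, mem_filter, ← e1, mem_filter, mem_inter]
        simp only [W, key, mem_filter, mem_univ, true_and, Prod.mk.injEq]
        constructor
        · rintro ⟨⟨h1, h2⟩, h3, rfl⟩
          exact ⟨⟨h1, h3, rfl⟩, h2⟩
        · rintro ⟨⟨h1, h3, rfl⟩, h2⟩
          exact ⟨⟨h1, h2⟩, h3, rfl⟩
      rw [e1, e2]
      exact card_rectangle_wrong A B o
    · have e1 : ({p ∈ S | key p = (l, o)} : Finset _) = ∅ := by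
        rw [filter_eq_empty_iff]
        intro p hp hk
        apply hl
        rw [← show h p.1 p.2 = l from congrArg Prod.fst hk]
        exact (mem_filter.1 hp).2
      rw [e1]
      have h1 := Real.sqrt_nonneg (12 ^ m)
      have h2 : (0 : ℝ) ≤ #{p ∈ S ∩ W | key p = (l, o)} := Nat.cast_nonneg _
      simp only [card_empty, Nat.cast_zero, zero_div]
      linarith
  have sum1 : (#S : ℝ) / 3 - (#L * 2 : ℕ) * √(12 ^ m) ≤ #(S ∩ W) := by
    rw [card_eq_sum_card_fiberwise hmaps,
      card_eq_sum_card_fiberwise (fun p hp => hmaps p (mem_inter.1 hp).1)]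
    push_cast
    refine le_trans (le_of_eq ?_) (sum_le_sum fiber)
    rw [sum_sub_distrib, sum_div, sum_const, card_product, card_univ, Fintype.card_bool,
      nsmul_eq_mul]
    push_cast
    rfl
  have bad : #(Sᶜ) + #(S ∩ W) ≤
      #{p : (Fin m → Bool) × (Fin m → Bool) |
        out p.1 p.2 ≠ decide (¬ 3 ∣ commonOnes p.1 p.2) ∨ T < (h p.1 p.2).length} := by
    rw [← card_union_of_disjoint (disjoint_compl_left.mono_right inter_subset_left)]
    refine card_le_card fun p hp => ?_
    rcases mem_union.1 hp with hp | hp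
    · refine mem_filter.2 ⟨mem_univ _, Or.inr ?_⟩
      simpa [S] using hp
    · exact mem_filter.2 ⟨mem_univ _, Or.inl (mem_filter.1 (mem_inter.1 hp).2).2⟩
  have hcard : Fintype.card (Fin m → Bool) = 2 ^ m := by simp
  have hcompl : #S + #(Sᶜ) = 2 ^ m * 2 ^ m := by
    rw [card_add_card_compl, Fintype.card_prod, hcard]
  rw [hcard]
  have arith := discrepancy_arith hmT
  have h4 : (4 : ℝ) ^ m = 2 ^ m * 2 ^ m := by rw [← mul_pow]; norm_num
  have hLr : (3 * #L : ℝ) ≤ 4 ^ (T + 1) := by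
    have : 3 * #L ≤ 4 ^ (T + 1) := by omega
    exact_mod_cast this
  have hLs : 3 * (#L : ℝ) * √(12 ^ m) ≤ 4 ^ (T + 1) * √(12 ^ m) := by gcongr
  have hp : (4 : ℝ) ^ (T + 3) = 16 * 4 ^ (T + 1) := by ring
  rw [hp] at arith
  have complR : (#S : ℝ) + #(Sᶜ) = 2 ^ m * 2 ^ m := by exact_mod_cast hcompl
  have c0 : (0 : ℝ) ≤ #(Sᶜ) := Nat.cast_nonneg _
  push_cast at sum1
  have total : (2 ^ m * 2 ^ m : ℝ) ≤ 4 * (#(Sᶜ) + #(S ∩ W)) := by linarith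
  refine le_trans ?_ (Nat.mul_le_mul_left 4 bad)
  exact_mod_cast total

section Symmetrization

variable {G : Type} [Group G] {k : ℕ}

/-- Inputs of `k + 1` players with product conjugate to `g`. For uniform `w` the inputs of the
first `k` players are uniform and independent. -/
def gaugedInput (w : Fin (k + 1) → G) (g : G) : Fin (k + 1) → G :=
  Fin.snoc (fun j : Fin k => (w j.castSucc)⁻¹ * w j.succ) ((w (Fin.last k))⁻¹ * g * w 0)

lemma prod_ofFn_inv_mul (w : Fin (k + 1) → G) :
    (List.ofFn fun j : Fin k => (w j.castSucc)⁻¹ * w j.succ).prod = (w 0)⁻¹ * w (Fin.last k) := by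
  induction k with
  | zero => simp
  | succ k ih =>
    have := ih fun j => w j.succ
    simp only [Fin.succ_castSucc] at this
    rw [List.ofFn_succ, List.prod_cons, this]
    simp [mul_assoc]

lemma prod_ofFn_gaugedInput (w : Fin (k + 1) → G) (g : G) :
    (List.ofFn (gaugedInput w g)).prod = (w 0)⁻¹ * g * w 0 := by
  rw [List.ofFn_succ', List.concat_eq_append, List.prod_append]
  simp [gaugedInput, prod_ofFn_inv_mul, mul_assoc]

/-- The change of gauge that moves a factor `a` into the input of player `i`. -/
def gaugeShift (i : Fin k) (a : G) (j : Fin (k + 1)) : G := if i.castSucc < j then a else 1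

lemma gaugedInput_castSucc (w : Fin (k + 1) → G) (g g' : G) (i : Fin k) :
    gaugedInput w g i.castSucc = gaugedInput w g' i.castSucc := by
  simp [gaugedInput]

lemma gaugedInput_gaugeShift_of_ne (z : Fin (k + 1) → G) (a a' b : G) (i : Fin k)
    (j : Fin (k + 1)) (hj : j ≠ i.castSucc) :
    gaugedInput (gaugeShift i a * z) (a * b) j = gaugedInput (gaugeShift i a' * z) (a' * b) j := by
  suffices h : ∀ a, gaugedInput (gaugeShift i a * z) (a * b) j = gaugedInput z b j by
    rw [h, h]
  intro a
  induction j using Fin.lastCases with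
  | last => simp [gaugedInput, gaugeShift, Fin.castSucc_lt_last, mul_assoc]
  | cast j =>
    have hji : j ≠ i := fun h => hj (h ▸ rfl)
    rcases lt_or_gt_of_ne hji with h | h
    · have h1 : ¬ i.castSucc < j.castSucc := by simpa using h.le
      have h2 : ¬ i.castSucc < j.succ := by
        rw [Fin.castSucc_lt_succ_iff]; exact not_le.2 h
      simp only [gaugedInput, Fin.snoc_castSucc, Pi.mul_apply, gaugeShift, h1, h2,
        if_false, one_mul]
    · have h1 : i.castSucc < j.castSucc := by simpa using h
      have h2 : i.castSucc < j.succ := h1.trans Fin.castSucc_lt_succ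
      simp only [gaugedInput, Fin.snoc_castSucc, Pi.mul_apply, gaugeShift, h1, h2, if_true]
      group

variable {U V : Type} [Fintype U] [Fintype V] [Fintype G]

open Finset in
/-- Each of the first `k` channels carries more than `T` bits on a sixth of the inputs. -/
lemma card_channel_long (D : CoordinatorProtocol (k + 1) G Bool) (a : U → G) (b : V → G)
    (f : U → V → Bool) (T : ℕ) (hard : HardForTwoParties T f)
    (herr : 12 * #{p : (Fin (k + 1) → G) × U × V |
      D.output (gaugedInput p.1 (a p.2.1 * b p.2.2)) ≠ f p.2.1 p.2.2}
      ≤ Fintype.card ((Fin (k + 1) → G) × U × V)) (i : Fin k) :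
    Fintype.card ((Fin (k + 1) → G) × U × V) ≤ 6 * #{p : (Fin (k + 1) → G) × U × V |
      T < (D.channels (gaugedInput p.1 (a p.2.1 * b p.2.2)) i.castSucc).length} := by
  classical
  let X : (Fin (k + 1) → G) → U → V → Fin (k + 1) → G := fun w u v => gaugedInput w (a u * b v)
  let Bad : (Fin (k + 1) → G) → U × V → Prop := fun w p =>
    D.output (X w p.1 p.2) ≠ f p.1 p.2 ∨ T < (D.channels (X w p.1 p.2) i.castSucc).length
  have hz : ∀ z : Fin (k + 1) → G, Fintype.card U * Fintype.card V
      ≤ 4 * #{p : U × V | Bad (gaugeShift i (a p.1) * z) p} := by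
    intro z
    refine hard (fun u v => D.channels (X (gaugeShift i (a u) * z) u v) i.castSucc)
      (fun u v => D.output (X (gaugeShift i (a u) * z) u v)) ?_
    intro u v u' v' h
    exact D.run_update_of_channels_eq i.castSucc h (gaugedInput_castSucc _ _ _ _)
      fun j hj => gaugedInput_gaugeShift_of_ne z _ _ _ i j hj
  have hsum : ∑ z : Fin (k + 1) → G, #{p : U × V | Bad (gaugeShift i (a p.1) * z) p}
      = #{p : (Fin (k + 1) → G) × U × V | Bad p.1 p.2} := by
    simp only [card_filter]
    rw [Fintype.sum_prod_type, sum_comm, sum_comm (s := (univ : Finset (Fin (k + 1) → G)))]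
    refine sum_congr rfl fun p _ => ?_
    exact Fintype.sum_equiv (Equiv.mulLeft (gaugeShift i (a p.1))) _ _ fun z => rfl
  have hcard : Fintype.card ((Fin (k + 1) → G) × U × V)
      ≤ 4 * #{p : (Fin (k + 1) → G) × U × V | Bad p.1 p.2} := by
    rw [← hsum, mul_sum, Fintype.card_prod, Fintype.card_prod, ← smul_eq_mul (Fintype.card _),
      ← card_univ, ← sum_const]
    exact sum_le_sum fun z _ => hz z
  have hunion := card_union_le
    {p : (Fin (k + 1) → G) × U × V |
      D.output (gaugedInput p.1 (a p.2.1 * b p.2.2)) ≠ f p.2.1 p.2.2}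
    {p : (Fin (k + 1) → G) × U × V |
      T < (D.channels (gaugedInput p.1 (a p.2.1 * b p.2.2)) i.castSucc).length}
  rw [← filter_or] at hunion
  have hunion' : #{p : (Fin (k + 1) → G) × U × V | Bad p.1 p.2} ≤ _ := hunion
  omega

open Finset in
/-- Symmetrization: a protocol that is correct on average on `gaugedInput`s has to solve the
two-party problem on each of the first `k` channels. -/
lemma mul_le_bits_of_hardForTwoParties [Nonempty U] [Nonempty V]
    (D : CoordinatorProtocol (k + 1) G Bool) (a : U → G) (b : V → G)
    (f : U → V → Bool) (T : ℕ) (hard : HardForTwoParties T f)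
    (herr : 12 * #{p : (Fin (k + 1) → G) × U × V |
      D.output (gaugedInput p.1 (a p.2.1 * b p.2.2)) ≠ f p.2.1 p.2.2}
      ≤ Fintype.card ((Fin (k + 1) → G) × U × V)) (B : ℕ) (hB : ∀ x, D.bits x ≤ B) :
    k * (T + 1) ≤ 6 * B := by
  classical
  let len : (Fin (k + 1) → G) × U × V → Fin (k + 1) → ℕ := fun p i =>
    (D.channels (gaugedInput p.1 (a p.2.1 * b p.2.2)) i).length
  set N := Fintype.card ((Fin (k + 1) → G) × U × V) with hN
  have hNpos : 0 < N := Fintype.card_pos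
  have hchannel : ∀ i : Fin k, (T + 1) * N ≤ 6 * ∑ p, len p i.castSucc := by
    intro i
    have h1 := card_channel_long D a b f T hard herr i
    have h2 : (T + 1) * #{p : (Fin (k + 1) → G) × U × V | T < len p i.castSucc}
        ≤ ∑ p, len p i.castSucc := by
      rw [card_filter, mul_sum]
      refine sum_le_sum fun p _ => ?_
      split_ifs with h
      · simpa using h
      · simp
    calc (T + 1) * N ≤ (T + 1) * (6 * #{p : (Fin (k + 1) → G) × U × V | T < len p i.castSucc}) :=
          Nat.mul_le_mul_left _ h1
      _ = 6 * ((T + 1) * #{p : (Fin (k + 1) → G) × U × V | T < len p i.castSucc}) := by ring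
      _ ≤ _ := Nat.mul_le_mul_left _ h2
  have hp : ∀ p, ∑ i : Fin k, len p i.castSucc ≤ B := by
    intro p
    refine le_trans ?_ (hB (gaugedInput p.1 (a p.2.1 * b p.2.2)))
    rw [← D.sum_length_channels, Fin.sum_univ_castSucc]
    exact Nat.le_add_right _ _
  refine Nat.le_of_mul_le_mul_right ?_ hNpos
  calc k * (T + 1) * N = ∑ _i : Fin k, (T + 1) * N := by simp [mul_assoc]
    _ ≤ ∑ i : Fin k, 6 * ∑ p, len p i.castSucc := sum_le_sum fun i _ => hchannel i
    _ = 6 * ∑ p, ∑ i : Fin k, len p i.castSucc := by rw [← mul_sum, sum_comm]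
    _ ≤ 6 * ∑ _p : (Fin (k + 1) → G) × U × V, B :=
        Nat.mul_le_mul_left _ (sum_le_sum fun p _ => hp p)
    _ = 6 * B * N := by rw [sum_const, card_univ, smul_eq_mul, ← hN]; ring

end Symmetrization

open Finset in
/-- If every input is bad with probability at most `1 / 12`, then some outcome of the coins makes
at most a twelfth of the inputs bad. -/
lemma PMF.exists_mem_support_card_le {Ω X : Type} [Fintype Ω] (P : PMF X) (bad : X → Ω → Prop)
    [∀ D ω, Decidable (bad D ω)] (h : ∀ ω, P.toOuterMeasure {D | bad D ω} ≤ 1 / 12) :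
    ∃ D ∈ P.support, 12 * #{ω | bad D ω} ≤ Fintype.card Ω := by
  by_contra! hcon
  have h1 : ∑ ω, P.toOuterMeasure {D | bad D ω} = ∑' D, P D * #{ω | bad D ω} := by
    simp only [PMF.toOuterMeasure_apply]
    rw [← Summable.tsum_finsetSum fun _ _ => ENNReal.summable]
    refine tsum_congr fun D => ?_
    rw [card_filter, Nat.cast_sum, mul_sum]
    refine sum_congr rfl fun ω _ => ?_
    by_cases hb : bad D ω <;> simp [hb]
  have h2 : 12 * ∑ ω, P.toOuterMeasure {D | bad D ω} ≤ Fintype.card Ω := by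
    calc 12 * ∑ ω, P.toOuterMeasure {D | bad D ω} ≤ 12 * ∑ _ω : Ω, (1 / 12 : ℝ≥0∞) := by
          gcongr with ω; exact h ω
      _ = Fintype.card Ω := by
          rw [sum_const, card_univ, nsmul_eq_mul, mul_left_comm, one_div,
            ENNReal.mul_inv_cancel (by norm_num) (by norm_num), mul_one]
  have h3 : ((Fintype.card Ω + 1 : ℕ) : ℝ≥0∞) ≤ 12 * ∑ ω, P.toOuterMeasure {D | bad D ω} := by
    rw [h1, ← ENNReal.tsum_mul_left, ← one_mul ((Fintype.card Ω + 1 : ℕ) : ℝ≥0∞), ← P.tsum_coe,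
      ← ENNReal.tsum_mul_right]
    refine ENNReal.tsum_le_tsum fun D => ?_
    by_cases hD : D ∈ P.support
    · rw [mul_left_comm]
      gcongr
      exact_mod_cast hcon D hD
    · rw [(P.apply_eq_zero_iff D).2 hD]; simp
  have h4 : Fintype.card Ω + 1 ≤ Fintype.card Ω := by exact_mod_cast h3.trans h2
  omega

open Classical in
/-- Two-party hardness of the cycle problem. -/
lemma exists_hardForTwoParties_cycle (n : ℕ) (hn : 2 ≤ n) :
    ∃ T, n ≤ 240 * (T + 1) ∧ ∃ (U V : Type) (_ : Fintype U) (_ : Fintype V) (_ : Nonempty U)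
      (_ : Nonempty V) (a : U → Equiv.Perm (Fin n)) (b : V → Equiv.Perm (Fin n)),
      HardForTwoParties T fun u v => decide ((a u * b v).IsCycleOn Set.univ) := by
  by_cases hsmall : n < 180
  · refine ⟨0, by omega, Bool, Unit, inferInstance, inferInstance, inferInstance, inferInstance,
      fun u => if u then finRotate n else 1, fun _ => 1, hardForTwoParties_zero _ ?_⟩
    have h1 : (finRotate n).IsCycleOn Set.univ := by
      have h := (isCycle_finRotate_of_le hn).isCycleOn
      have hs := support_finRotate_of_le hn
      convert h
      ext x
      simp only [Set.mem_univ, Set.mem_ofPred_eq, true_iff]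
      rw [← Equiv.Perm.mem_support, hs]
      exact Finset.mem_univ x
    have h2 : ¬ (1 : Equiv.Perm (Fin n)).IsCycleOn Set.univ := by
      rw [Equiv.Perm.isCycleOn_univ_iff]
      intro h
      have := h ⟨0, by omega⟩ ⟨1, by omega⟩
      simp at this
    simp [h1, h2]
  · have hq : 60 * (n / 60) ≤ n := Nat.mul_div_le n 60
    obtain ⟨a, b, hab⟩ := reducesToCycle_fin (10 * (n / 60)) n (by omega) (by omega)
    refine ⟨n / 60 - 3, by omega, _, _, inferInstance, inferInstance, inferInstance, inferInstance,
      a, b, ?_⟩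
    simp only [hab]
    exact hardForTwoParties_commonOnes (by omega)

lemma cycleProblem_gaugedInput {k n : ℕ} (w : Fin (k + 1) → Equiv.Perm (Fin n))
    (g : Equiv.Perm (Fin n)) [Decidable (g.IsCycleOn Set.univ)] :
    cycleProblem (k + 1) n (gaugedInput w g) = decide (g.IsCycleOn Set.univ) := by
  rw [cycleProblem, prod_ofFn_gaugedInput, decide_eq_decide]
  exact Equiv.Perm.isCycleOn_univ_conj g (w 0)

theorem mainTheorem8 :
    ∃ c : ℝ≥0, 0 < c ∧ ∀ s n : ℕ, 2 ≤ s → 2 ≤ n →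
      (c : ℝ≥0∞) * s * n ≤ publicCoinComplexity (cycleProblem s n) (1 / 12) := by
  classical
  refine ⟨1 / 2880, by norm_num, fun s n hs hn => ?_⟩
  refine le_iInf₂ fun P hP => ?_
  obtain ⟨k, rfl⟩ : ∃ k, s = k + 1 := ⟨s - 1, by omega⟩
  obtain ⟨T, hT, U, V, _, _, _, _, a, b, hard⟩ := exists_hardForTwoParties_cycle n hn
  obtain ⟨D, hD, herr⟩ := PMF.exists_mem_support_card_le P
    (fun D (p : (Fin (k + 1) → Equiv.Perm (Fin n)) × U × V) =>
      D.output (gaugedInput p.1 (a p.2.1 * b p.2.2))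
        ≠ decide ((a p.2.1 * b p.2.2).IsCycleOn Set.univ))
    (fun p => by
      have := hP (gaugedInput p.1 (a p.2.1 * b p.2.2))
      rwa [cycleProblem_gaugedInput] at this)
  obtain ⟨x, hx⟩ := Finite.exists_max D.bits
  have hbits := mul_le_bits_of_hardForTwoParties D a b _ T hard herr _ hx
  have hnat : (k + 1) * n ≤ 2880 * D.bits x := by
    calc (k + 1) * n ≤ (2 * k) * (240 * (T + 1)) := Nat.mul_le_mul (by omega) hT
      _ = 480 * (k * (T + 1)) := by ring
      _ ≤ 480 * (6 * D.bits x) := Nat.mul_le_mul_left _ hbits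
      _ = 2880 * D.bits x := by ring
  have hcost : (D.bits x : ℝ≥0∞) ≤ P.cost :=
    (le_iSup (fun x => (D.bits x : ℝ≥0∞)) x).trans
      (le_iSup₂ (f := fun D (_ : D ∈ P.support) => ⨆ x, (D.bits x : ℝ≥0∞)) D hD)
  refine le_trans ?_ hcost
  have hreal : (1 / 2880 : ℝ≥0) * (k + 1 : ℕ) * n ≤ D.bits x := by
    have : (((k + 1) * n : ℕ) : ℝ≥0) ≤ ((2880 * D.bits x : ℕ) : ℝ≥0) := by exact_mod_cast hnat
    rw [Nat.cast_mul, Nat.cast_mul] at this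
    rw [mul_assoc, one_div, inv_mul_le_iff₀ (by norm_num)]
    exact_mod_cast this
  exact_mod_cast hreal
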